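/- Let $(\Omega,\mathcal A,\mathbb P)$ be a probability space with a measurable flow $(\theta_x)_{x\in\mathbb R^2}$ leaving $\mathbb P$ invariant, and let $\Phi=\sum_n\delta_{T_n}$ be a simple point process on $\mathbb R^2$ (the access points), with finite intensity $\lambda=\mathbb E[\Phi([0,1)^2)]$ and compatible with the flow: $\Phi(\omega,B+x)=\Phi(\theta_x\omega,B)$ for all $\omega$, $x$ and Borel sets $B$. Each atom $T_n$ carries a tier $J(T_n)\in\{1,\dots,K\}$ and a measurable field $S_n(y)\in[0,\infty]$, $y\in\mathbb R^2$; both are marks, i.e. $J(T_0)\circ\theta_{T_n}=J(T_n)$ and $S_0(y)\circ\theta_{T_n}=S_n(y+T_n)$, where $T_0$ denotes the atom at the origin after the shift; moreover $S_n(T_n)=\infty$. Assume that for every $y\in\mathbb R^2$ there is almost surely a unique atom whose field at $y$ is the largest, and let $\kappa(y)$ be this atom (where there is no unique such atom, put $\kappa(y)=y$). Let $\mathcal C(T_n)=\{y\in\mathbb R^2:\kappa(y)=T_n\}$ be the association cell of $T_n$ and $|\mathcal C(T_n)|$ its area. Let $\mathbb P^o(A)=\lambda^{-1}\,\mathbb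 E\big[\sum_{T_n\in[0,1)^2}\mathbf 1_A\circ\theta_{T_n}\big]$ be the Palm probability of $\Phi$, and $\mathbb P^{o,i}=\mathbb P^o(\,\cdot\mid J(T_0)=i)$, with expectation $\mathbb E^{o,i}$. Let $i$ be a tier with $\mathbb P(J(\kappa(0))=i)>0$. Then: (0) $\mathbb P^{o,i}$ is a well-defined probability measure, $\mathbb P^{o,i}$-almost surely the origin is an atom $T_0$ of $\Phi$ and $\kappa(0)=T_0=0$, and $0<\mathbb E^{o,i}[|\mathcal C(T_0)|]<\infty$; and conditionally on $J(\kappa(0))=i$, almost surely $\kappa(0)$ is an atom of $\Phi$ and $0<|\mathcal C(\kappa(0))|<\infty$. (1) If $|\mathcal C(T_0)|$ has a density $f^{o,i}_{|\mathcal C(T_0)|}$ under $\mathbb P^{o,i}$, then, conditionally on $J(\kappa(0))=i$, the area $|\mathcal C(\kappa(0))|$ of the cell containing the origin has a density, given for almost every $c\in\mathbb{R}$ by $$f^{i}_{|\mathcal C(\kappa(0))|}(c)=\frac{\max(c,0)\,f^{o,i}_{|\mathcal C(T_0)|}(c)}{\mathbb E^{o,i}[|\mathcal C(T_0)|]}$$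 (for $c<0$ both sides vanish). (2) For every real $d$, provided that $d>-1$ or that $|\mathcal C(T_0)|>0$ holds $\mathbb P^{o,i}$-almost surely (as it does when the density in (1) exists), $$\mathbb E\big[|\mathcal C(\kappa(0))|^d\,\big|\,J(\kappa(0))=i\big]=\frac{\mathbb E^{o,i}\big[|\mathcal C(T_0)|^{d+1}\big]}{\mathbb E^{o,i}\big[|\mathcal C(T_0)|\big]},$$ as an equality in $[0,\infty]$. -/

import Mathlib

open MeasureTheory ProbabilityTheory
open scoped ENNReal

/-- The Euclidean plane. -/
abbrev Plane : Type := EuclideanSpace ℝ (Fin 2)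

/-- A `K`-tier random network over the measurable space `Ω`: a measurable flow, a compatible simple
point process of access points, a compatible tier label for each access point, and a compatible
collection of `[0, ∞]`-valued fields, one for each access point.  The values of `tier` and `field`
at points that are not atoms of the point process play no role. -/
structure HetNet (Ω : Type*) [MeasurableSpace Ω] (K : ℕ) where
  /-- the flow `θ_x` on `Ω` -/
  flow : Plane → Ω → Ω
  flow_zero : ∀ ω, flow 0 ω = ω
  flow_add : ∀ x y ω, flow (x + y) ω = flow x (flow y ω)
  measurable_flow : Measurable fun p : Plane × Ω => flow p.1 p.2
  /-- the point process of access points, as a random counting measure -/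
  pp : Ω → Measure Plane
  measurable_pp : Measurable pp
  /-- each realization is the counting measure of a locally finite set of points -/
  simple_pp : ∀ ω, ∃ s : Set Plane,
    (∀ r : ℝ, (s ∩ Metric.closedBall 0 r).Finite) ∧ pp ω = Measure.count.restrict s
  /-- compatibility with the flow: `Φ(ω, B + x) = Φ(θ_x ω, B)` -/
  pp_flow : ∀ x ω (B : Set Plane), MeasurableSet B → pp ω ((fun b => b + x) '' B) = pp (flow x ω) B
  /-- `tier ω x` is the tier of the access point located at `x` -/
  tier : Ω → Plane → Fin K
  measurable_tier : Measurable fun p : Ω × Plane => tier p.1 p.2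
  /-- the tiers are marks of the point process -/
  tier_flow : ∀ ω x, pp ω {x} ≠ 0 → tier (flow x ω) 0 = tier ω x
  /-- `field ω x y` is the value at the location `y` of the field of the access point at `x` -/
  field : Ω → Plane → Plane → ℝ≥0∞
  measurable_field : Measurable fun p : Ω × Plane × Plane => field p.1 p.2.1 p.2.2
  /-- the fields are marks of the point process -/
  field_flow : ∀ ω x y, pp ω {x} ≠ 0 → field (flow x ω) 0 y = field ω x (y + x)
  /-- the field of an access point is infinite at its own location -/
  field_self : ∀ ω x, pp ω {x} ≠ 0 → field ω x x = ∞

namespace HetNet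

variable {Ω : Type*} [MeasurableSpace Ω] {K : ℕ} (N : HetNet Ω K)

/-- The access points, i.e. the atoms of the point process. -/
def atoms (ω : Ω) : Set Plane := {x | N.pp ω {x} ≠ 0}

/-- `x` is the access point whose field is (uniquely) the largest at the location `y`. -/
def IsArgsup (ω : Ω) (y x : Plane) : Prop :=
  x ∈ N.atoms ω ∧ ∀ x' ∈ N.atoms ω, x' ≠ x → N.field ω x' y < N.field ω x y

open Classical in
/-- The association map `κ(y)`: the access point whose field is the largest at `y`.  If there is no
unique such access point, then by convention `κ(y) = y` (so `y` is not associated with any access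
point, unless it is itself the location of one). -/
noncomputable def assoc (ω : Ω) (y : Plane) : Plane :=
  if h : ∃ x, N.IsArgsup ω y x then h.choose else y

/-- The association cell of the access point at `x`. -/
def cell (ω : Ω) (x : Plane) : Set Plane := {y | N.assoc ω y = x}

/-- The area of the association cell of the access point at `x`. -/
noncomputable def area (ω : Ω) (x : Plane) : ℝ≥0∞ := volume (N.cell ω x)

/-- The probability measure `P` is invariant under the flow. -/
def IsStationary (P : Measure Ω) : Prop := ∀ x, MeasurePreserving (N.flow x) P P

/-- At every given location there is almost surely a unique access point with the largest field. -/
def ArgsupWellDefined (P : Measure Ω) : Prop := ∀ y, ∀ᵐ ω ∂P, ∃ x, N.IsArgsup ω y x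

/-- The half-open unit square, a Borel set of area one. -/
def unitSquare : Set Plane := {x | ∀ j, x j ∈ Set.Ico (0 : ℝ) 1}

/-- The intensity: the mean number of access points per unit area. -/
noncomputable def intensity (P : Measure Ω) : ℝ≥0∞ := ∫⁻ ω, N.pp ω unitSquare ∂P

/-- The Palm probability of the point process,
`P^o(A) = λ⁻¹ E[∑_{T_n ∈ [0,1)²} 1_A(θ_{T_n} ω)]`. -/
noncomputable def palm (P : Measure Ω) : Measure Ω :=
  (N.intensity P)⁻¹ •
    P.bind fun ω => ((N.pp ω).restrict unitSquare).map fun x => N.flow x ω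

/-- The Palm probability of tier `i`: the Palm probability conditioned on the event that the
typical access point `T_0`, which is located at the origin, belongs to tier `i`. -/
noncomputable def palmTier (P : Measure Ω) (i : Fin K) : Measure Ω :=
  cond (N.palm P) {ω | N.tier ω 0 = i}

/-- The event that the access point with which the origin is associated belongs to tier `i`. -/
def originTier (i : Fin K) : Set Ω := {ω | N.tier ω (N.assoc ω 0) = i}

end HetNet

/-!
The law of the cell containing the origin is the area-biased law of the typical cell.  This is a
mass transport argument.  Let every location `y` send the mass `f (θ_x ω)` to the access point `x`
that serves it.  The mean mass sent from the origin is `E[f (θ_{κ(0)} ω)]`, since almost surely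
`κ(0)` is an access point, while the mean mass received by the access points of the unit square is the
integral of `f · |C(T_0)|` against the unnormalized Palm measure.  The two agree by invariance of
`P` under the flow (`lintegral_pp_mul_lintegral_of_covariant`, `lintegral_mul_area_palmMass`).

With `f` a function of the area on the event that the tier at the origin is `i`, this gives
`E[φ(|C(κ(0))|) | J(κ(0)) = i] = E^{o,i}[φ(|C(T_0)|) |C(T_0)|] / E^{o,i}[|C(T_0)|]` for all
measurable `φ ≥ 0` (`lintegral_cond_originTier`), where the intensity and the Palm probability of the tier
cancel.  Indicators `φ` give the positivity, the finiteness and the density, powers the moments.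

`Ω` is not assumed complete, so the measurability of the association map needs care.
The point process is an s-finite kernel, and an existential quantifier over its atoms says that an
integral against this kernel is not zero (`measurableSet_exists_atom`).  Hence the event that `x`
has the largest field at `y` is jointly measurable, and so are the association map and the area.
-/

namespace HetNet

variable {Ω : Type*} [MeasurableSpace Ω] {K : ℕ} (N : HetNet Ω K)

/-! ### The point process as a kernel -/

lemma mem_atoms {ω : Ω} {x : Plane} : x ∈ N.atoms ω ↔ N.pp ω {x} ≠ 0 := Iff.rfl

lemma countable_of_finite_inter_closedBall {s : Set Plane}
    (hs : ∀ r : ℝ, (s ∩ Metric.closedBall 0 r).Finite) : s.Countable := by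
  have h : s = ⋃ n : ℕ, s ∩ Metric.closedBall 0 (n : ℝ) := by
    rw [← Set.inter_iUnion, Metric.iUnion_closedBall_nat, Set.inter_univ]
  rw [h]
  exact Set.countable_iUnion fun n => (hs n).countable

/-- The locally finite set in `HetNet.simple_pp` is the set of atoms. -/
lemma pp_eq_count_restrict (ω : Ω) :
    (∀ r : ℝ, (N.atoms ω ∩ Metric.closedBall 0 r).Finite) ∧
      N.pp ω = Measure.count.restrict (N.atoms ω) := by
  obtain ⟨s, hs, hpp⟩ := N.simple_pp ω
  have h : N.atoms ω = s := by
    ext x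
    rw [mem_atoms, hpp, Measure.restrict_apply (measurableSet_singleton x)]
    by_cases hx : x ∈ s
    · simp [Set.inter_eq_left.2 (Set.singleton_subset_iff.2 hx), hx]
    · simp [Set.singleton_inter_eq_empty.2 hx, hx]
  exact h ▸ ⟨hs, hpp⟩

lemma countable_atoms (ω : Ω) : (N.atoms ω).Countable :=
  countable_of_finite_inter_closedBall (N.pp_eq_count_restrict ω).1

lemma lintegral_pp (ω : Ω) (g : Plane → ℝ≥0∞) :
    ∫⁻ x, g x ∂(N.pp ω) = ∑' x : N.atoms ω, g x := by
  rw [(N.pp_eq_count_restrict ω).2, lintegral_countable _ (N.countable_atoms ω)]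
  simp

lemma pp_ne_zero_iff {ω : Ω} {B : Set Plane} (hB : MeasurableSet B) :
    N.pp ω B ≠ 0 ↔ ∃ x ∈ N.atoms ω, x ∈ B := by
  rw [← lintegral_indicator_one hB, lintegral_pp, Ne, ENNReal.tsum_eq_zero]
  simp

/-- A ball contains a finite, hence natural, number of access points. -/
lemma exists_pp_eq_natCast (ω : Ω) {B : Set Plane} (hB : MeasurableSet B) {r : ℝ}
    (hr : B ⊆ Metric.closedBall 0 r) : ∃ m : ℕ, N.pp ω B = m := by
  have hfin : (B ∩ N.atoms ω).Finite :=
    ((N.pp_eq_count_restrict ω).1 r).subset fun x hx => ⟨hx.2, hr hx.1⟩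
  refine ⟨hfin.toFinset.card, ?_⟩
  rw [(N.pp_eq_count_restrict ω).2, Measure.restrict_apply hB, Measure.count_apply_finite _ hfin]

/-- The point process as a transition kernel. -/
noncomputable def ppKernel : Kernel Ω Plane := ⟨N.pp, N.measurable_pp⟩

/-- The mean number of points need not be bounded over `Ω`, so each annulus is split further
according to the number of points it contains. -/
instance : IsSFiniteKernel N.ppKernel := by
  classical
  let A : ℕ → Set Plane := fun n => {x | ⌈‖x‖⌉₊ = n}
  have hA : ∀ n, MeasurableSet (A n) := fun n =>
    (Nat.measurable_ceil.comp measurable_norm) (measurableSet_singleton n)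
  have hsub : ∀ n, A n ⊆ Metric.closedBall 0 (n : ℝ) := fun n x hx => by
    rw [mem_closedBall_zero_iff]
    exact (Nat.le_ceil _).trans (by exact_mod_cast (show ⌈‖x‖⌉₊ = n from hx).le)
  have hE : ∀ n m : ℕ, MeasurableSet {ω | N.pp ω (A n) = m} := fun n m =>
    ((Measure.measurable_coe (hA n)).comp N.measurable_pp) (measurableSet_singleton _)
  let η : ℕ × ℕ → Kernel Ω Plane := fun p =>
    Kernel.piecewise (hE p.1 p.2) (N.ppKernel.restrict (hA p.1)) 0
  have hfin : ∀ p, IsFiniteKernel (η p) := fun p => by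
    refine ⟨⟨p.2, ENNReal.natCast_lt_top _, fun ω => ?_⟩⟩
    simp only [η, Kernel.piecewise_apply]
    split_ifs with h
    · rw [Kernel.restrict_apply, Measure.restrict_apply_univ]
      exact (show N.pp ω (A p.1) = p.2 from h).le
    · simp
  have hsum : N.ppKernel = Kernel.sum η := by
    ext ω B hB
    rw [Kernel.sum_apply' _ _ hB, ENNReal.tsum_prod']
    have hn : ∀ n, ∑' m, η (n, m) ω B = N.pp ω (B ∩ A n) := fun n => by
      obtain ⟨m, hm⟩ := N.exists_pp_eq_natCast ω (hA n) (hsub n)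
      rw [tsum_eq_single m]
      · simp only [η, Kernel.piecewise_apply]
        rw [if_pos (by exact hm), Kernel.restrict_apply, Measure.restrict_apply hB]
        rfl
      · intro m' hm'
        simp only [η, Kernel.piecewise_apply]
        rw [if_neg]
        · simp
        · simp only [Set.mem_ofPred_eq, hm]
          exact_mod_cast hm'.symm
    simp_rw [hn]
    rw [← measure_iUnion]
    · rw [← Set.inter_iUnion, (show ⋃ n, A n = Set.univ from
        Set.eq_univ_of_forall fun x => Set.mem_iUnion.2 ⟨_, rfl⟩), Set.inter_univ]
      rfl
    · intro a b hab
      refine Set.disjoint_left.2 fun x hx hx' => hab ?_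
      exact (show ⌈‖x‖⌉₊ = a from hx.2).symm.trans hx'.2
    · exact fun n => hB.inter (hA n)
  rw [hsum]
  exact Kernel.isSFiniteKernel_sum (hκs := fun p => inferInstance)

instance (ω : Ω) : SFinite (N.pp ω) := inferInstanceAs (SFinite (N.ppKernel ω))

/-! ### Joint measurability -/

section Measurability

variable {α : Type*} [MeasurableSpace α]

lemma measurable_lintegral_pp {w : α → Ω} (hw : Measurable w) {g : α → Plane → ℝ≥0∞}
    (hg : Measurable (Function.uncurry g)) :
    Measurable fun a => ∫⁻ x, g a x ∂(N.pp (w a)) :=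
  hg.lintegral_kernel_prod_right (κ := N.ppKernel.comap w hw)

/-- Existential quantification over the access points preserves measurability, because it says
that an integral against the point process does not vanish. -/
lemma measurableSet_exists_atom {w : α → Ω} (hw : Measurable w) {E : Set (α × Plane)}
    (hE : MeasurableSet E) : MeasurableSet {a | ∃ x ∈ N.atoms (w a), (a, x) ∈ E} := by
  have h : {a | ∃ x ∈ N.atoms (w a), (a, x) ∈ E} =
      {a | N.ppKernel.comap w hw a (Prod.mk a ⁻¹' E) = 0}ᶜ := by
    ext a
    exact (N.pp_ne_zero_iff (measurable_prodMk_left hE)).symm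
  rw [h]
  exact (Kernel.measurable_kernel_prodMk_left hE (measurableSet_singleton 0)).compl

lemma measurableSet_mem_atoms : MeasurableSet {p : Ω × Plane | p.2 ∈ N.atoms p.1} := by
  convert N.measurableSet_exists_atom (w := fun p : Ω × Plane => p.1) measurable_fst
    (measurableSet_eq_fun (f := fun q : (Ω × Plane) × Plane => q.2) (g := fun q => q.1.2)
      (by fun_prop) (by fun_prop)) using 2
  simp

lemma measurableSet_isArgsup :
    MeasurableSet {p : (Ω × Plane) × Plane | N.IsArgsup p.1.1 p.1.2 p.2} := by
  have hf : ∀ {β : Type _} [MeasurableSpace β] {u : β → Ω} {v v' : β → Plane}, Measurable u →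
      Measurable v → Measurable v' → Measurable fun b => N.field (u b) (v b) (v' b) :=
    fun hu hv hv' => N.measurable_field.comp (hu.prodMk (hv.prodMk hv'))
  have h1 : MeasurableSet {p : (Ω × Plane) × Plane | p.2 ∈ N.atoms p.1.1} :=
    ((measurable_fst.comp measurable_fst).prodMk measurable_snd) N.measurableSet_mem_atoms
  have hE : MeasurableSet {q : ((Ω × Plane) × Plane) × Plane | q.2 ≠ q.1.2 ∧
      N.field q.1.1.1 q.1.2 q.1.1.2 ≤ N.field q.1.1.1 q.2 q.1.1.2} := by
    refine MeasurableSet.inter ?_ ?_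
    · exact (measurableSet_eq_fun (by fun_prop) (by fun_prop)).compl
    · exact measurableSet_le (hf (by fun_prop) (by fun_prop) (by fun_prop))
        (hf (by fun_prop) (by fun_prop) (by fun_prop))
  have h2 := N.measurableSet_exists_atom (w := fun p : (Ω × Plane) × Plane => p.1.1)
    (by fun_prop) hE
  convert h1.inter h2.compl using 1
  ext p
  simp [IsArgsup]

lemma IsArgsup.eq {N : HetNet Ω K} {ω : Ω} {y x x' : Plane} (h : N.IsArgsup ω y x)
    (h' : N.IsArgsup ω y x') : x = x' := by
  by_contra hne
  exact lt_asymm (h.2 x' h'.1 (Ne.symm hne)) (h'.2 x h.1 hne)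

lemma IsArgsup.assoc_eq {N : HetNet Ω K} {ω : Ω} {y x : Plane} (h : N.IsArgsup ω y x) :
    N.assoc ω y = x := by
  have hex : ∃ x, N.IsArgsup ω y x := ⟨x, h⟩
  rw [assoc, dif_pos hex]
  exact hex.choose_spec.eq h

lemma assoc_eq_self {ω : Ω} {y : Plane} (h : ¬ ∃ x, N.IsArgsup ω y x) : N.assoc ω y = y := by
  rw [assoc, dif_neg h]

lemma measurable_assoc : Measurable fun p : Ω × Plane => N.assoc p.1 p.2 := by
  intro B hB
  have hE : ∀ {C : Set Plane}, MeasurableSet C →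
      MeasurableSet {p : Ω × Plane | ∃ x ∈ N.atoms p.1, N.IsArgsup p.1 p.2 x ∧ x ∈ C} :=
    fun hC => N.measurableSet_exists_atom measurable_fst
      (N.measurableSet_isArgsup.inter (measurable_snd hC))
  convert (hE hB).union ((hE MeasurableSet.univ).compl.inter (measurable_snd hB)) using 1
  ext ⟨ω, y⟩
  simp only [Set.mem_preimage, Set.mem_union, Set.mem_ofPred_eq, Set.mem_inter_iff,
    Set.mem_compl_iff, Set.mem_univ, and_true]
  by_cases h : ∃ x, N.IsArgsup ω y x
  · obtain ⟨x, hx⟩ := h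
    rw [hx.assoc_eq]
    constructor
    · exact fun hB => Or.inl ⟨x, hx.1, hx, hB⟩
    · rintro (⟨x', -, hx', hB⟩ | ⟨h, -⟩)
      · rwa [hx.eq hx']
      · exact absurd ⟨x, hx.1, hx⟩ h
  · rw [N.assoc_eq_self h]
    constructor
    · exact fun hB => Or.inr ⟨fun ⟨x, _, hx⟩ => h ⟨x, hx⟩, hB⟩
    · rintro (⟨x', -, hx', -⟩ | ⟨-, hB⟩)
      · exact absurd ⟨x', hx'⟩ h
      · exact hB

lemma measurable_area : Measurable fun p : Ω × Plane => N.area p.1 p.2 := by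
  have h : MeasurableSet {q : (Ω × Plane) × Plane | N.assoc q.1.1 q.2 = q.1.2} :=
    measurableSet_eq_fun (N.measurable_assoc.comp
      ((measurable_fst.comp measurable_fst).prodMk measurable_snd)) (by fun_prop)
  exact measurable_measure_prodMk_left h

lemma measurable_assoc_zero : Measurable fun ω => N.assoc ω 0 :=
  N.measurable_assoc.comp measurable_prodMk_right

lemma measurable_area_zero : Measurable fun ω => N.area ω 0 :=
  N.measurable_area.comp measurable_prodMk_right

lemma measurable_area_assoc : Measurable fun ω => N.area ω (N.assoc ω 0) :=
  N.measurable_area.comp (measurable_id.prodMk N.measurable_assoc_zero)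

lemma measurableSet_originTier (i : Fin K) : MeasurableSet (N.originTier i) :=
  N.measurable_tier.comp (measurable_id.prodMk N.measurable_assoc_zero) (measurableSet_singleton i)

lemma measurableSet_tier_zero (i : Fin K) : MeasurableSet {ω | N.tier ω 0 = i} :=
  N.measurable_tier.comp measurable_prodMk_right (measurableSet_singleton i)

end Measurability

/-! ### Covariance under the flow -/

lemma lintegral_pp_flow (x : Plane) (ω : Ω) {g : Plane → ℝ≥0∞} (hg : Measurable g) :
    ∫⁻ z, g z ∂(N.pp (N.flow x ω)) = ∫⁻ z, g (z - x) ∂(N.pp ω) := by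
  have h : N.pp (N.flow x ω) = (N.pp ω).map (· - x) := by
    ext B hB
    rw [Measure.map_apply (measurable_sub_const x) hB, ← N.pp_flow x ω B hB]
    congr 1
    ext z
    simp [sub_eq_add_neg]
  rw [h, lintegral_map hg (measurable_sub_const x)]

lemma mem_atoms_flow {x : Plane} {ω : Ω} {z : Plane} :
    z ∈ N.atoms (N.flow x ω) ↔ z + x ∈ N.atoms ω := by
  rw [mem_atoms, mem_atoms, ← N.pp_flow x ω {z} (measurableSet_singleton z), Set.image_singleton]

/-- The marks are read off at the origin, so both sides are moved there by the flow. -/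
lemma field_flow_of_mem_atoms {x : Plane} {ω : Ω} {z y : Plane}
    (hz : z ∈ N.atoms (N.flow x ω)) :
    N.field (N.flow x ω) z y = N.field ω (z + x) (y + x) := by
  have h1 := N.field_flow (N.flow x ω) z (y - z) hz
  have h2 := N.field_flow ω (z + x) (y - z) (N.mem_atoms_flow.1 hz)
  rw [sub_add_cancel, ← N.flow_add] at h1
  rw [← h1, h2]
  congr 1
  abel

lemma isArgsup_flow {x : Plane} {ω : Ω} {y z : Plane} :
    N.IsArgsup (N.flow x ω) y z ↔ N.IsArgsup ω (y + x) (z + x) := by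
  constructor
  · rintro ⟨hz, h⟩
    refine ⟨N.mem_atoms_flow.1 hz, fun z' hz' hne => ?_⟩
    have hz'' : z' - x ∈ N.atoms (N.flow x ω) := N.mem_atoms_flow.2 (by rwa [sub_add_cancel])
    have := h _ hz'' fun e => hne (by rw [← e, sub_add_cancel])
    rwa [N.field_flow_of_mem_atoms hz, N.field_flow_of_mem_atoms hz'', sub_add_cancel] at this
  · rintro ⟨hz, h⟩
    have hz₀ := N.mem_atoms_flow.2 hz
    refine ⟨hz₀, fun z' hz' hne => ?_⟩
    rw [N.field_flow_of_mem_atoms hz₀, N.field_flow_of_mem_atoms hz']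
    exact h _ (N.mem_atoms_flow.1 hz') fun e => hne (add_right_cancel e)

lemma assoc_flow (x : Plane) (ω : Ω) (y : Plane) :
    N.assoc (N.flow x ω) y = N.assoc ω (y + x) - x := by
  by_cases h : ∃ z, N.IsArgsup ω (y + x) z
  · obtain ⟨z, hz⟩ := h
    rw [hz.assoc_eq]
    refine IsArgsup.assoc_eq (N.isArgsup_flow.2 ?_)
    rwa [sub_add_cancel]
  · rw [N.assoc_eq_self h, N.assoc_eq_self, add_sub_cancel_right]
    exact fun ⟨z, hz⟩ => h ⟨_, N.isArgsup_flow.1 hz⟩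

lemma area_flow (x : Plane) (ω : Ω) (z : Plane) :
    N.area (N.flow x ω) z = N.area ω (z + x) := by
  have h : N.cell (N.flow x ω) z = (· + x) ⁻¹' N.cell ω (z + x) := by
    ext y
    simp [cell, N.assoc_flow, sub_eq_iff_eq_add]
  rw [area, h, measure_preimage_add_right]
  rfl

/-- An access point always serves its own location, since its field is infinite there. -/
lemma assoc_eq_of_mem_atoms {ω : Ω} {x : Plane} (hx : x ∈ N.atoms ω) : N.assoc ω x = x := by
  by_cases h : ∃ z, N.IsArgsup ω x z
  · obtain ⟨z, hz⟩ := h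
    rw [hz.assoc_eq]
    by_contra hne
    have := hz.2 x hx (Ne.symm hne)
    rw [N.field_self ω x hx] at this
    exact not_top_lt this
  · exact N.assoc_eq_self h

/-! ### The Palm measure and the inversion formula -/

lemma measurableSet_unitSquare : MeasurableSet unitSquare := by
  have : unitSquare = ⋂ j : Fin 2, {x : Plane | x j ∈ Set.Ico (0 : ℝ) 1} := by
    ext x; simp [unitSquare]
  rw [this]
  exact MeasurableSet.iInter fun j => (by fun_prop : Measurable fun x : Plane => x j)
    measurableSet_Ico

lemma volume_unitSquare : volume unitSquare = 1 := by
  have h : unitSquare =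
      WithLp.ofLp ⁻¹' (Set.univ.pi fun _ : Fin 2 => Set.Ico (0 : ℝ) 1) := by
    ext x; simp [unitSquare, -Fin.forall_fin_two]
  rw [h, (PiLp.volume_preserving_ofLp (Fin 2)).measure_preimage
    (MeasurableSet.univ_pi fun _ => measurableSet_Ico).nullMeasurableSet, Real.volume_pi_Ico]
  simp

/-- The Palm measure before normalization by the intensity, a measure of total mass equal to the
intensity.  Unlike `HetNet.palm`, it is meaningful also when the intensity vanishes. -/
noncomputable def palmMass (P : Measure Ω) : Measure Ω :=
  P.bind fun ω => ((N.pp ω).restrict unitSquare).map fun x => N.flow x ω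

lemma palm_eq_smul (P : Measure Ω) : N.palm P = (N.intensity P)⁻¹ • N.palmMass P := rfl

lemma measurable_flow_comp {α : Type*} [MeasurableSpace α] {u : α → Plane} {w : α → Ω}
    (hu : Measurable u) (hw : Measurable w) : Measurable fun a => N.flow (u a) (w a) :=
  N.measurable_flow.comp (hu.prodMk hw)

lemma lintegral_palmMass (P : Measure Ω) {f : Ω → ℝ≥0∞} (hf : Measurable f) :
    ∫⁻ ω, f ω ∂(N.palmMass P) =
      ∫⁻ ω, ∫⁻ x, unitSquare.indicator 1 x * f (N.flow x ω) ∂(N.pp ω) ∂P := by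
  have hflow : ∀ ω, Measurable fun x => N.flow x ω := fun ω =>
    N.measurable_flow_comp measurable_id measurable_const
  have h : ∀ (ω : Ω) (g : Ω → ℝ≥0∞), Measurable g →
      ∫⁻ ω', g ω' ∂(((N.pp ω).restrict unitSquare).map fun x => N.flow x ω) =
        ∫⁻ x, unitSquare.indicator 1 x * g (N.flow x ω) ∂(N.pp ω) := fun ω g hg => by
    rw [lintegral_map hg (hflow ω), ← lintegral_indicator measurableSet_unitSquare]
    congr with x
    by_cases hx : x ∈ unitSquare <;> simp [hx]
  have hm : Measurable fun ω =>
      ((N.pp ω).restrict unitSquare).map fun x => N.flow x ω := by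
    refine Measure.measurable_of_measurable_coe _ fun B hB => ?_
    simp_rw [← lintegral_indicator_one hB]
    simp_rw [h _ _ (measurable_one.indicator hB)]
    refine N.measurable_lintegral_pp measurable_id ?_
    exact ((measurable_one.indicator measurableSet_unitSquare).comp measurable_snd).mul
      ((measurable_one.indicator hB).comp (N.measurable_flow_comp measurable_snd measurable_fst))
  rw [palmMass, Measure.lintegral_bind hm.aemeasurable hf.aemeasurable]
  simp_rw [h _ f hf]

lemma palmMass_univ (P : Measure Ω) : N.palmMass P Set.univ = N.intensity P := by
  rw [← lintegral_one, N.lintegral_palmMass P measurable_const, intensity]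
  simp_rw [mul_one, lintegral_indicator_one measurableSet_unitSquare]

lemma ae_palmMass_zero_mem_atoms (P : Measure Ω) : ∀ᵐ ω ∂(N.palmMass P), 0 ∈ N.atoms ω := by
  have hB : MeasurableSet {ω | 0 ∈ N.atoms ω}ᶜ :=
    (measurable_prodMk_right (y := (0 : Plane)) N.measurableSet_mem_atoms).compl
  rw [ae_iff]
  change N.palmMass P {ω | 0 ∈ N.atoms ω}ᶜ = 0
  rw [← lintegral_indicator_one hB, N.lintegral_palmMass P (measurable_one.indicator hB)]
  have h : ∀ ω, ∫⁻ x, unitSquare.indicator 1 x *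
      ({ω | 0 ∈ N.atoms ω}ᶜ.indicator 1 (N.flow x ω) : ℝ≥0∞) ∂(N.pp ω) = 0 := fun ω => by
    rw [lintegral_pp, ENNReal.tsum_eq_zero]
    rintro ⟨x, hx⟩
    have : 0 ∈ N.atoms (N.flow x ω) := N.mem_atoms_flow.2 (by rwa [zero_add])
    simp [this]
  simp [h]

/-- Summing over the access points a quantity restricted to the one that serves the origin. -/
lemma lintegral_pp_assoc_zero {ω : Ω} (h : N.assoc ω 0 ∈ N.atoms ω) (g : Plane → ℝ≥0∞) :
    ∫⁻ x, g x * (N.cell ω x).indicator 1 0 ∂(N.pp ω) = g (N.assoc ω 0) := by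
  rw [lintegral_pp, tsum_eq_single ⟨N.assoc ω 0, h⟩]
  · simp [cell]
  · rintro ⟨x, hx⟩ hne
    have : N.assoc ω 0 ≠ x := fun e => hne (Subtype.ext e.symm)
    simp [cell, this]

lemma ae_assoc_zero_mem_atoms {P : Measure Ω} (hargsup : N.ArgsupWellDefined P) :
    ∀ᵐ ω ∂P, N.assoc ω 0 ∈ N.atoms ω := by
  filter_upwards [hargsup 0] with ω ⟨x, hx⟩
  rw [hx.assoc_eq]
  exact hx.1

/-- A mass transport principle: if the mass `h ω y x` sent from the location `y` to the access
point `x` is covariant under the flow, then the mean mass received per unit volume by the access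
points is the mean mass sent from the origin.  The flow moves each location `y` to the origin, after
which the weight `u`, translated by `y`, is integrated out. -/
lemma lintegral_pp_mul_lintegral_of_covariant {P : Measure Ω} [SFinite P]
    (hstat : N.IsStationary P) {u : Plane → ℝ≥0∞} (hu : Measurable u) (hu1 : ∫⁻ x, u x = 1)
    {h : Ω → Plane → Plane → ℝ≥0∞}
    (hh : Measurable fun p : (Ω × Plane) × Plane => h p.1.1 p.1.2 p.2)
    (hcov : ∀ v ω y z, h (N.flow v ω) y z = h ω (y + v) (z + v)) :
    ∫⁻ ω, ∫⁻ x, (u x * ∫⁻ y, h ω y x) ∂(N.pp ω) ∂P = ∫⁻ ω, ∫⁻ x, h ω 0 x ∂(N.pp ω) ∂P := by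
  have hy : ∀ ω x, Measurable fun y => h ω y x := fun ω x =>
    hh.comp (measurable_prodMk_left.prodMk measurable_const)
  have hx : ∀ ω y, Measurable fun x => h ω y x := fun ω y =>
    hh.comp (measurable_prodMk_left (x := (ω, y)))
  have hG : Measurable fun p : Ω × Plane => ∫⁻ x, u x * h p.1 p.2 x ∂(N.pp p.1) :=
    N.measurable_lintegral_pp measurable_fst ((hu.comp measurable_snd).mul hh)
  have hshift : ∀ y ω, ∫⁻ x, u x * h (N.flow (-y) ω) y x ∂(N.pp (N.flow (-y) ω)) =
      ∫⁻ z, u (z + y) * h ω 0 z ∂(N.pp ω) := fun y ω => by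
    have hm : Measurable fun x => u x * h (N.flow (-y) ω) y x := hu.mul (hx _ y)
    rw [N.lintegral_pp_flow _ _ hm]
    simp_rw [hcov, sub_neg_eq_add, add_neg_cancel, add_neg_cancel_right]
  calc ∫⁻ ω, ∫⁻ x, (u x * ∫⁻ y, h ω y x) ∂(N.pp ω) ∂P
      = ∫⁻ ω, ∫⁻ x, (∫⁻ y, u x * h ω y x) ∂(N.pp ω) ∂P := by
        simp_rw [lintegral_const_mul _ (hy _ _)]
    _ = ∫⁻ ω, (∫⁻ y, ∫⁻ x, u x * h ω y x ∂(N.pp ω)) ∂P := by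
        refine lintegral_congr fun ω => lintegral_lintegral_swap (Measurable.aemeasurable ?_)
        exact (hu.comp measurable_fst).mul
          (hh.comp ((measurable_const.prodMk measurable_snd).prodMk measurable_fst))
    _ = ∫⁻ y, ∫⁻ ω, ∫⁻ x, u x * h ω y x ∂(N.pp ω) ∂P :=
        lintegral_lintegral_swap hG.aemeasurable
    _ = ∫⁻ y, ∫⁻ ω, ∫⁻ z, u (z + y) * h ω 0 z ∂(N.pp ω) ∂P := by
        refine lintegral_congr fun y => ?_
        simp_rw [← hshift]
        exact ((hstat (-y)).lintegral_comp (hG.comp measurable_prodMk_right)).symm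
    _ = ∫⁻ ω, (∫⁻ y, ∫⁻ z, u (z + y) * h ω 0 z ∂(N.pp ω)) ∂P := by
        refine (lintegral_lintegral_swap (Measurable.aemeasurable ?_)).symm
        refine N.measurable_lintegral_pp measurable_fst ?_
        exact (hu.comp (measurable_snd.add (measurable_snd.comp measurable_fst))).mul
          (hh.comp (((measurable_fst.comp measurable_fst).prodMk measurable_const).prodMk
            measurable_snd))
    _ = ∫⁻ ω, ∫⁻ z, (∫⁻ y, u (z + y) * h ω 0 z) ∂(N.pp ω) ∂P := by
        refine lintegral_congr fun ω => lintegral_lintegral_swap (Measurable.aemeasurable ?_)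
        exact (hu.comp (measurable_snd.add measurable_fst)).mul ((hx ω 0).comp measurable_snd)
    _ = ∫⁻ ω, ∫⁻ z, h ω 0 z ∂(N.pp ω) ∂P := by
        refine lintegral_congr fun ω => lintegral_congr fun z => ?_
        have hm : Measurable fun y => u (z + y) := hu.comp (measurable_const_add z)
        rw [lintegral_mul_const _ hm,
          lintegral_add_left_eq_self u z, hu1, one_mul]

/-- The inversion formula: weighting the typical access point by the area of its cell yields the
access point that serves the origin. -/
theorem lintegral_mul_area_palmMass {P : Measure Ω} [SFinite P] (hstat : N.IsStationary P)
    (hargsup : N.ArgsupWellDefined P) {f : Ω → ℝ≥0∞} (hf : Measurable f) :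
    ∫⁻ ω, f ω * N.area ω 0 ∂(N.palmMass P) = ∫⁻ ω, f (N.flow (N.assoc ω 0) ω) ∂P := by
  -- each location sends the mass `f (θ_x ω)` to the access point `x` that serves it
  have hcell : Measurable fun p : (Ω × Plane) × Plane =>
      (N.cell p.1.1 p.2).indicator (1 : Plane → ℝ≥0∞) p.1.2 := by
    have : MeasurableSet {p : (Ω × Plane) × Plane | N.assoc p.1.1 p.1.2 = p.2} :=
      measurableSet_eq_fun (N.measurable_assoc.comp measurable_fst) measurable_snd
    exact measurable_one.indicator this
  have hh : Measurable fun p : (Ω × Plane) × Plane =>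
      f (N.flow p.2 p.1.1) * (N.cell p.1.1 p.2).indicator (1 : Plane → ℝ≥0∞) p.1.2 :=
    (hf.comp (N.measurable_flow_comp measurable_snd (measurable_fst.comp measurable_fst))).mul hcell
  have hcov : ∀ v ω y z,
      f (N.flow z (N.flow v ω)) * (N.cell (N.flow v ω) z).indicator (1 : Plane → ℝ≥0∞) y =
        f (N.flow (z + v) ω) * (N.cell ω (z + v)).indicator (1 : Plane → ℝ≥0∞) (y + v) :=
    fun v ω y z => by
      by_cases hz : N.assoc ω (y + v) = z + v <;>
        simp [cell, N.assoc_flow, sub_eq_iff_eq_add, N.flow_add, hz]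
  have harea : ∀ ω x, ∫⁻ y, f (N.flow x ω) * (N.cell ω x).indicator (1 : Plane → ℝ≥0∞) y =
      f (N.flow x ω) * N.area (N.flow x ω) 0 := fun ω x => by
    have hm : MeasurableSet (N.cell ω x) := measurableSet_eq_fun
      (N.measurable_assoc.comp measurable_prodMk_left) measurable_const
    rw [lintegral_const_mul _ (measurable_one.indicator hm), lintegral_indicator_one hm,
      N.area_flow, zero_add, area]
  have key := N.lintegral_pp_mul_lintegral_of_covariant hstat
    (h := fun ω y x => f (N.flow x ω) * (N.cell ω x).indicator (1 : Plane → ℝ≥0∞) y)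
    (measurable_one.indicator measurableSet_unitSquare)
    (by rw [lintegral_indicator_one measurableSet_unitSquare, volume_unitSquare]) hh hcov
  simp_rw [harea] at key
  have hm : Measurable fun ω => f ω * N.area ω 0 := hf.mul N.measurable_area_zero
  rw [N.lintegral_palmMass P hm]
  refine key.trans (lintegral_congr_ae ?_)
  filter_upwards [N.ae_assoc_zero_mem_atoms hargsup] with ω hω
  exact N.lintegral_pp_assoc_zero hω fun z => f (N.flow z ω)

/-! ### Conditioning on a tier -/

/-- The inversion formula for functions of the tier and of the area of the cell. -/
lemma setLIntegral_area_originTier {P : Measure Ω} [SFinite P] (hstat : N.IsStationary P)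
    (hargsup : N.ArgsupWellDefined P) (i : Fin K) {φ : ℝ≥0∞ → ℝ≥0∞} (hφ : Measurable φ) :
    ∫⁻ ω in N.originTier i, φ (N.area ω (N.assoc ω 0)) ∂P =
      ∫⁻ ω in {ω | N.tier ω 0 = i}, φ (N.area ω 0) * N.area ω 0 ∂(N.palmMass P) := by
  have hT := N.measurableSet_tier_zero i
  have key := N.lintegral_mul_area_palmMass hstat hargsup
    (f := {ω | N.tier ω 0 = i}.indicator fun ω => φ (N.area ω 0))
    ((hφ.comp N.measurable_area_zero).indicator hT)
  rw [← lintegral_indicator (N.measurableSet_originTier i), ← lintegral_indicator hT]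
  have h : ∀ ω, {ω | N.tier ω 0 = i}.indicator (fun ω => φ (N.area ω 0)) ω * N.area ω 0 =
      {ω | N.tier ω 0 = i}.indicator (fun ω => φ (N.area ω 0) * N.area ω 0) ω := fun ω =>
    (Set.indicator_mul_left (i := ω) {ω | N.tier ω 0 = i} (fun ω => φ (N.area ω 0))
      fun ω => N.area ω 0).symm
  simp_rw [h] at key
  rw [key]
  refine lintegral_congr_ae ?_
  filter_upwards [N.ae_assoc_zero_mem_atoms hargsup] with ω hω
  have htier := N.tier_flow ω _ hω
  by_cases hi : N.tier ω (N.assoc ω 0) = i <;> simp [originTier, htier, hi, N.area_flow]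

variable {N} {P : Measure Ω} [IsProbabilityMeasure P] {i : Fin K}

lemma setLIntegral_area_palmMass (hstat : N.IsStationary P) (hargsup : N.ArgsupWellDefined P) :
    ∫⁻ ω in {ω | N.tier ω 0 = i}, N.area ω 0 ∂(N.palmMass P) = P (N.originTier i) := by
  simpa using (N.setLIntegral_area_originTier hstat hargsup i measurable_one).symm

lemma palmMass_tier_ne_zero (hstat : N.IsStationary P) (hargsup : N.ArgsupWellDefined P)
    (hi : P (N.originTier i) ≠ 0) : N.palmMass P {ω | N.tier ω 0 = i} ≠ 0 := fun h =>
  hi (by rw [← setLIntegral_area_palmMass hstat hargsup, Measure.restrict_eq_zero.2 h,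
    lintegral_zero_measure])

lemma intensity_ne_zero (hstat : N.IsStationary P) (hargsup : N.ArgsupWellDefined P)
    (hi : P (N.originTier i) ≠ 0) : N.intensity P ≠ 0 := fun h =>
  palmMass_tier_ne_zero hstat hargsup hi <|
    measure_mono_null (Set.subset_univ _) (by rw [palmMass_univ, h])

lemma palm_tier_ne_zero (hstat : N.IsStationary P) (hint : N.intensity P ≠ ∞)
    (hargsup : N.ArgsupWellDefined P) (hi : P (N.originTier i) ≠ 0) :
    N.palm P {ω | N.tier ω 0 = i} ≠ 0 := by
  rw [palm_eq_smul, Measure.smul_apply, smul_eq_mul]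
  exact mul_ne_zero (ENNReal.inv_ne_zero.2 hint) (palmMass_tier_ne_zero hstat hargsup hi)

lemma isProbabilityMeasure_palm (hstat : N.IsStationary P) (hint : N.intensity P ≠ ∞)
    (hargsup : N.ArgsupWellDefined P) (hi : P (N.originTier i) ≠ 0) :
    IsProbabilityMeasure (N.palm P) := by
  refine ⟨?_⟩
  rw [palm_eq_smul, Measure.smul_apply, palmMass_univ, smul_eq_mul]
  exact ENNReal.inv_mul_cancel (intensity_ne_zero hstat hargsup hi) hint

lemma isProbabilityMeasure_palmTier (hstat : N.IsStationary P) (hint : N.intensity P ≠ ∞)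
    (hargsup : N.ArgsupWellDefined P) (hi : P (N.originTier i) ≠ 0) :
    IsProbabilityMeasure (N.palmTier P i) := by
  have := isProbabilityMeasure_palm hstat hint hargsup hi
  exact cond_isProbabilityMeasure (palm_tier_ne_zero hstat hint hargsup hi)

lemma exists_palmTier_eq_smul (hstat : N.IsStationary P) (hint : N.intensity P ≠ ∞)
    (hargsup : N.ArgsupWellDefined P) (hi : P (N.originTier i) ≠ 0) :
    ∃ c : ℝ≥0∞, c ≠ 0 ∧ c ≠ ∞ ∧
      N.palmTier P i = c • (N.palmMass P).restrict {ω | N.tier ω 0 = i} := by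
  have := isProbabilityMeasure_palm hstat hint hargsup hi
  refine ⟨(N.palm P {ω | N.tier ω 0 = i})⁻¹ * (N.intensity P)⁻¹, ?_, ?_, ?_⟩
  · exact mul_ne_zero (ENNReal.inv_ne_zero.2 (measure_ne_top _ _)) (ENNReal.inv_ne_zero.2 hint)
  · exact ENNReal.mul_ne_top (ENNReal.inv_ne_top.2 (palm_tier_ne_zero hstat hint hargsup hi))
      (ENNReal.inv_ne_top.2 (intensity_ne_zero hstat hargsup hi))
  · rw [palmTier, ProbabilityTheory.cond, mul_smul, palm_eq_smul,
      Measure.restrict_smul]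

lemma lintegral_area_palmTier_pos (hstat : N.IsStationary P) (hint : N.intensity P ≠ ∞)
    (hargsup : N.ArgsupWellDefined P) (hi : P (N.originTier i) ≠ 0) :
    0 < ∫⁻ ω, N.area ω 0 ∂(N.palmTier P i) := by
  obtain ⟨c, hc0, -, hc⟩ := exists_palmTier_eq_smul hstat hint hargsup hi
  rw [hc, lintegral_smul_measure, setLIntegral_area_palmMass hstat hargsup]
  exact pos_iff_ne_zero.2 (mul_ne_zero hc0 hi)

lemma lintegral_area_palmTier_lt_top (hstat : N.IsStationary P) (hint : N.intensity P ≠ ∞)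
    (hargsup : N.ArgsupWellDefined P) (hi : P (N.originTier i) ≠ 0) :
    ∫⁻ ω, N.area ω 0 ∂(N.palmTier P i) < ∞ := by
  obtain ⟨c, -, hc1, hc⟩ := exists_palmTier_eq_smul hstat hint hargsup hi
  rw [hc, lintegral_smul_measure, setLIntegral_area_palmMass hstat hargsup]
  exact ENNReal.mul_lt_top hc1.lt_top (measure_lt_top _ _)

lemma ae_palmTier_area_lt_top (hstat : N.IsStationary P) (hint : N.intensity P ≠ ∞)
    (hargsup : N.ArgsupWellDefined P) (hi : P (N.originTier i) ≠ 0) :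
    ∀ᵐ ω ∂(N.palmTier P i), N.area ω 0 < ∞ :=
  ae_lt_top N.measurable_area_zero
    (lintegral_area_palmTier_lt_top hstat hint hargsup hi).ne

lemma ae_palmTier_zero_mem_atoms (hstat : N.IsStationary P) (hint : N.intensity P ≠ ∞)
    (hargsup : N.ArgsupWellDefined P) (hi : P (N.originTier i) ≠ 0) :
    ∀ᵐ ω ∂(N.palmTier P i), 0 ∈ N.atoms ω := by
  obtain ⟨c, -, -, hc⟩ := exists_palmTier_eq_smul hstat hint hargsup hi
  rw [hc]
  exact Measure.ae_smul_measure (ae_restrict_of_ae (N.ae_palmMass_zero_mem_atoms P)) c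

/-- Given the tier, the area of the cell containing the origin has the area-biased law of the area
of the typical cell. -/
theorem lintegral_cond_originTier (hstat : N.IsStationary P) (hint : N.intensity P ≠ ∞)
    (hargsup : N.ArgsupWellDefined P) (hi : P (N.originTier i) ≠ 0) {φ : ℝ≥0∞ → ℝ≥0∞}
    (hφ : Measurable φ) :
    ∫⁻ ω, φ (N.area ω (N.assoc ω 0)) ∂(cond P (N.originTier i)) =
      (∫⁻ ω, φ (N.area ω 0) * N.area ω 0 ∂(N.palmTier P i)) /
        ∫⁻ ω, N.area ω 0 ∂(N.palmTier P i) := by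
  obtain ⟨c, hc0, hc1, hc⟩ := exists_palmTier_eq_smul hstat hint hargsup hi
  rw [hc, lintegral_smul_measure, lintegral_smul_measure, setLIntegral_area_palmMass hstat hargsup,
    ← N.setLIntegral_area_originTier hstat hargsup i hφ, ProbabilityTheory.cond,
    lintegral_smul_measure, smul_eq_mul, smul_eq_mul, smul_eq_mul,
    ENNReal.mul_div_mul_left _ _ hc0 hc1, ENNReal.div_eq_inv_mul]

/-- A typical cell of area zero has no weight in the law of the cell containing the origin, so it
can be disregarded when almost sure properties of the area are transferred. -/
lemma ae_cond_originTier (hstat : N.IsStationary P) (hint : N.intensity P ≠ ∞)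
    (hargsup : N.ArgsupWellDefined P) (hi : P (N.originTier i) ≠ 0) {B : Set ℝ≥0∞}
    (hB : MeasurableSet B) (h : ∀ᵐ ω ∂(N.palmTier P i), N.area ω 0 ≠ 0 → N.area ω 0 ∈ B) :
    ∀ᵐ ω ∂(cond P (N.originTier i)), N.area ω (N.assoc ω 0) ∈ B := by
  have h1 := lintegral_cond_originTier hstat hint hargsup hi (φ := Bᶜ.indicator 1)
    (measurable_one.indicator hB.compl)
  have h2 : ∫⁻ ω, Bᶜ.indicator 1 (N.area ω 0) * N.area ω 0 ∂(N.palmTier P i) = 0 := by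
    refine (lintegral_congr_ae ?_).trans lintegral_zero
    filter_upwards [h] with ω hω
    by_cases h0 : N.area ω 0 = 0
    · simp [h0]
    · simp [hω h0]
  have hm : Measurable fun ω => Bᶜ.indicator (1 : ℝ≥0∞ → ℝ≥0∞) (N.area ω (N.assoc ω 0)) :=
    (measurable_one.indicator hB.compl).comp N.measurable_area_assoc
  rw [h2, ENNReal.zero_div, lintegral_eq_zero_iff hm] at h1
  filter_upwards [h1] with ω hω
  by_contra hnot
  simp [hnot] at hω

/-- The law of the area of the cell containing the origin has density `c / E[area]` with respect to
the law of the area of the typical cell. -/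
lemma map_area_cond_originTier (hstat : N.IsStationary P) (hint : N.intensity P ≠ ∞)
    (hargsup : N.ArgsupWellDefined P) (hi : P (N.originTier i) ≠ 0) :
    (cond P (N.originTier i)).map (fun ω => (N.area ω (N.assoc ω 0)).toReal) =
      ((N.palmTier P i).map fun ω => (N.area ω 0).toReal).withDensity
        fun c => ENNReal.ofReal c / ∫⁻ ω, N.area ω 0 ∂(N.palmTier P i) := by
  ext B hB
  have hg : Measurable fun c : ℝ => ENNReal.ofReal c / ∫⁻ ω, N.area ω 0 ∂(N.palmTier P i) :=
    ENNReal.measurable_ofReal.div_const _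
  have hφ : Measurable fun a : ℝ≥0∞ => B.indicator (1 : ℝ → ℝ≥0∞) a.toReal :=
    (measurable_one.indicator hB).comp ENNReal.measurable_toReal
  rw [← lintegral_indicator_one hB, lintegral_map (measurable_one.indicator hB)
    N.measurable_area_assoc.ennreal_toReal,
    lintegral_cond_originTier hstat hint hargsup hi hφ, withDensity_apply _ hB,
    ← lintegral_indicator hB, lintegral_map (hg.indicator hB)
    N.measurable_area_zero.ennreal_toReal, div_eq_mul_inv, ← lintegral_mul_const]
  · refine lintegral_congr_ae ?_
    filter_upwards [ae_palmTier_area_lt_top hstat hint hargsup hi] with ω hω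
    by_cases h : (N.area ω 0).toReal ∈ B
    · simp [h, ENNReal.ofReal_toReal hω.ne, div_eq_mul_inv]
    · simp [h]
  · exact (hφ.comp N.measurable_area_zero).mul N.measurable_area_zero

end HetNet

/-! ### The law of the area of the cell containing the origin -/

/-- For `-1 < d < 0` and `a = 0` this is `∞ * 0 = 0`. -/
lemma ENNReal.rpow_mul_self_eq_rpow_add_one {a : ℝ≥0∞} (ha : a ≠ ∞) {d : ℝ}
    (h : -1 < d ∨ a ≠ 0) : a ^ d * a = a ^ (d + 1) := by
  rcases eq_or_ne a 0 with rfl | h0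
  · rcases h with h | h
    · rw [mul_zero, ENNReal.zero_rpow_of_pos (by linarith)]
    · exact absurd rfl h
  · rw [ENNReal.rpow_add _ _ h0 ha, ENNReal.rpow_one]

theorem corollary1 {Ω : Type*} [MeasurableSpace Ω] {K : ℕ} (N : HetNet Ω K)
    (P : Measure Ω) [IsProbabilityMeasure P]
    (hstat : N.IsStationary P) (hint : N.intensity P ≠ ∞) (hargsup : N.ArgsupWellDefined P)
    (i : Fin K) (hi : P (N.originTier i) ≠ 0) :
    -- under the Palm probability of tier `i` the origin is the location of an access point, which
    -- serves the origin, and the mean area of its cell is positive and finite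
    (IsProbabilityMeasure (N.palmTier P i) ∧
      (∀ᵐ ω ∂(N.palmTier P i), 0 ∈ N.atoms ω ∧ N.assoc ω 0 = 0) ∧
      0 < ∫⁻ ω, N.area ω 0 ∂(N.palmTier P i) ∧ ∫⁻ ω, N.area ω 0 ∂(N.palmTier P i) < ∞) ∧
    -- given that the origin is served by tier `i`, its cell has positive and finite area
    (∀ᵐ ω ∂(cond P (N.originTier i)),
      N.assoc ω 0 ∈ N.atoms ω ∧ 0 < N.area ω (N.assoc ω 0) ∧ N.area ω (N.assoc ω 0) < ∞) ∧
    -- the density of the area of the cell containing the origin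
    (HasPDF (fun ω => (N.area ω 0).toReal) (N.palmTier P i) volume →
      HasPDF (fun ω => (N.area ω (N.assoc ω 0)).toReal) (cond P (N.originTier i)) volume ∧
      ∀ᵐ c : ℝ,
        pdf (fun ω => (N.area ω (N.assoc ω 0)).toReal) (cond P (N.originTier i)) volume c =
          ENNReal.ofReal c * pdf (fun ω => (N.area ω 0).toReal) (N.palmTier P i) volume c /
            ∫⁻ ω, N.area ω 0 ∂(N.palmTier P i)) ∧
    -- the moments
    (∀ d : ℝ, (-1 < d ∨ ∀ᵐ ω ∂(N.palmTier P i), N.area ω 0 ≠ 0) →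
      ∫⁻ ω, N.area ω (N.assoc ω 0) ^ d ∂(cond P (N.originTier i)) =
        (∫⁻ ω, N.area ω 0 ^ (d + 1) ∂(N.palmTier P i)) /
          ∫⁻ ω, N.area ω 0 ∂(N.palmTier P i)) := by
  have hX : Measurable fun ω => (N.area ω (N.assoc ω 0)).toReal :=
    N.measurable_area_assoc.ennreal_toReal
  refine ⟨⟨HetNet.isProbabilityMeasure_palmTier hstat hint hargsup hi, ?_,
    HetNet.lintegral_area_palmTier_pos hstat hint hargsup hi,
    HetNet.lintegral_area_palmTier_lt_top hstat hint hargsup hi⟩, ?_, ?_, ?_⟩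
  · filter_upwards [HetNet.ae_palmTier_zero_mem_atoms hstat hint hargsup hi] with ω hω
    exact ⟨hω, N.assoc_eq_of_mem_atoms hω⟩
  · have h0 := HetNet.ae_cond_originTier hstat hint hargsup hi
      (measurableSet_singleton (0 : ℝ≥0∞)).compl (.of_forall fun ω h => h)
    have h1 := HetNet.ae_cond_originTier hstat hint hargsup hi
      (measurableSet_singleton ∞).compl
      ((HetNet.ae_palmTier_area_lt_top hstat hint hargsup hi).mono fun ω h _ => h.ne)
    filter_upwards [h0, h1,
      cond_absolutelyContinuous.ae_le (N.ae_assoc_zero_mem_atoms hargsup)] with ω h0 h1 h2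
    exact ⟨h2, pos_iff_ne_zero.2 h0, lt_top_iff_ne_top.2 h1⟩
  · intro hpdf
    have hg : Measurable fun c : ℝ =>
        ENNReal.ofReal c / ∫⁻ ω, N.area ω 0 ∂(N.palmTier P i) :=
      ENNReal.measurable_ofReal.div_const _
    have hp := measurable_pdf (fun ω => (N.area ω 0).toReal) (N.palmTier P i) volume
    have hmap := HetNet.map_area_cond_originTier hstat hint hargsup hi
    rw [map_eq_withDensity_pdf (fun ω => (N.area ω 0).toReal) (N.palmTier P i) volume,
      ← withDensity_mul _ hp hg] at hmap
    have hpdf' := hasPDF_of_map_eq_withDensity hX.aemeasurable _ (hp.mul hg).aemeasurable hmap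
    refine ⟨hpdf', ?_⟩
    filter_upwards [(pdf.eq_of_map_eq_withDensity _ (hp.mul hg).aemeasurable).1 hmap] with c hc
    rw [hc, Pi.mul_apply, mul_comm, ENNReal.mul_div_right_comm]
  · intro d hd
    rw [HetNet.lintegral_cond_originTier hstat hint hargsup hi (φ := fun a => a ^ d) (by fun_prop)]
    congr 1
    refine lintegral_congr_ae ?_
    have hd' : ∀ᵐ ω ∂(N.palmTier P i), -1 < d ∨ N.area ω 0 ≠ 0 :=
      hd.elim (fun h => .of_forall fun _ => .inl h) fun h => h.mono fun _ => .inr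
    filter_upwards [hd', HetNet.ae_palmTier_area_lt_top hstat hint hargsup hi] with ω h h'
    exact ENNReal.rpow_mul_self_eq_rpow_add_one h'.ne h
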